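/- A graph $\Gamma$ (no loops or multiple edges) that is connected, with distance function $d$ and spheres $S(\gamma,n)=\{\beta : d(\gamma,\beta)=n\}$, satisfies the \emph{Distinct Spheres Condition} (DSC) if there is a vertex $\alpha$ such that for all distinct vertices $\gamma,\delta$ with $d(\alpha,\gamma)=d(\alpha,\delta)$ one has $S(\gamma,n)\neq S(\delta,n)$ for infinitely many $n$. The graph is \emph{2-distinguishable} if its distinguishing number (the least number of colors in a vertex coloring that is preserved by no non-identity automorphism) is at most $2$; it has \emph{infinite motion} if every non-identity automorphism moves infinitely many vertices; and it is \emph{denumerable} if its vertex set is countably infinite. Let $r\ge 2$ be an integer, let $T$ be an $r$-valent tree, let $k\geq 7$ be an odd integer, and let $C_k$ be the cycle of length $k$. Let $\Gamma=T\otimes C_k$ be the direct product, whose vertex set is $VT\times VC_k$ and in which $(\alpha,\zeta)$ and $(\beta,\eta)$ are adjacent if and only if $\alpha,\beta$ are adjacent in $T$ and $\zeta,\eta$ are adjacent in $C_k$. Then $\Gamma$ is a connected, denumerable, vertex-transitive graph that does not satisfy the DSC, yet $\Gamma$ is 2-distinguishable and has infinite motion. Hence, even among connected denumerable vertex-transitive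 graphs, 2-distinguishability does not imply the DSC, and infinite motion does not imply the DSC. -/

import Mathlib

namespace DistinctSpheres

/-- The direct (weak, categorical) product of two graphs: two pairs are adjacent if and only if
both coordinates are adjacent. -/
def directProduct {V W : Type*} (G : SimpleGraph V) (H : SimpleGraph W) :
    SimpleGraph (V × W) where
  Adj x y := G.Adj x.1 y.1 ∧ H.Adj x.2 y.2
  symm := ⟨fun _ _ h => ⟨h.1.symm, h.2.symm⟩⟩
  loopless := ⟨fun _ h => G.irrefl h.1⟩

/-- The graph is vertex-transitive: its automorphism group is transitive on the vertices. -/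
def IsVertexTransitive {V : Type*} (G : SimpleGraph V) : Prop :=
  ∀ a b : V, ∃ g : G ≃g G, g a = b

/-- The sphere of radius `n` with center `a` (for connected graphs). -/
def sphere {V : Type*} (G : SimpleGraph V) (a : V) (n : ℕ) : Set V :=
  {b | G.dist a b = n}

/-- The Distinct Spheres Condition (for connected graphs). -/
def DSC {V : Type*} (G : SimpleGraph V) : Prop :=
  ∃ a : V, ∀ c d : V, c ≠ d → G.dist a c = G.dist a d →
    {n : ℕ | sphere G c n ≠ sphere G d n}.Infinite

/-- A vertex coloring is distinguishing if only the identity automorphism preserves it. -/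
def IsDistinguishingColoring {V C : Type*} (G : SimpleGraph V) (f : V → C) : Prop :=
  ∀ g : G ≃g G, (∀ v, f (g v) = f v) → ∀ v, g v = v

/-- The distinguishing number of a graph: the least number of colors in a distinguishing
coloring (`⊤` if no finite number suffices). -/
noncomputable def distinguishingNumber {V : Type*} (G : SimpleGraph V) : ℕ∞ :=
  sInf {m : ℕ∞ | ∃ n : ℕ, m = n ∧ ∃ f : V → Fin n, IsDistinguishingColoring G f}

/-- A graph is `n`-distinguishable if its distinguishing number is at most `n`. -/
def IsDistinguishable {V : Type*} (n : ℕ) (G : SimpleGraph V) : Prop :=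
  distinguishingNumber G ≤ n

theorem isDistinguishable_iff {V : Type*} (n : ℕ) (G : SimpleGraph V) :
    IsDistinguishable n G ↔ ∃ f : V → Fin n, IsDistinguishingColoring G f := by
  constructor
  · intro h
    have hne : {m : ℕ∞ | ∃ n : ℕ, m = n ∧ ∃ f : V → Fin n,
        IsDistinguishingColoring G f}.Nonempty := by
      by_contra hc
      rw [Set.not_nonempty_iff_eq_empty] at hc
      simp [IsDistinguishable, distinguishingNumber, hc] at h
    obtain ⟨m, hm, f, hf⟩ := csInf_mem hne
    have hle : m ≤ n := by
      have h' : distinguishingNumber G ≤ n := h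
      rw [distinguishingNumber, hm] at h'
      exact_mod_cast h'
    exact ⟨fun v => Fin.castLE hle (f v), fun g hg => hf g fun v =>
      Fin.castLE_injective hle (hg v)⟩
  · rintro ⟨f, hf⟩
    exact sInf_le ⟨n, rfl, f, hf⟩

/-- Infinite motion: every non-identity automorphism moves infinitely many vertices. -/
def HasInfiniteMotion {V : Type*} (G : SimpleGraph V) : Prop :=
  ∀ g : G ≃g G, (∃ v, g v ≠ v) → {v | g v ≠ v}.Infinite

end DistinctSpheres

/-! An odd cycle has walks of every length `n ≥ k` between any two vertices. So in the product the
cycle coordinate is invisible at long range: the distance is the tree distance once that is at least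
`k`, and at most `k + 1` otherwise. Two vertices over the same tree vertex then have equal spheres
of every radius above `k + 1`, which defeats the DSC.

Locally the coordinate still counts: `z` is the only common neighbor of `z + 1` and `z - 1`. Hence
an automorphism fixing everything farther from a root than `a` fixes the vertices over `a` too, so
motion is infinite.

For 2-distinguishability, apply Baire category to the space of 2-colorings. A generic `f` has
iterates `A ^ n f` of the adjacency operator that separate all vertices, so a color-preserving
automorphism is trivial. The separation needed rests on `A` being a tensor product whose cycle
factor is invertible for odd `k`. -/

namespace DistinctSpheres

open SimpleGraph

/-! ### Trees: geodesics, countability, vertex-transitivity -/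

section Tree

variable {V : Type*} {T : SimpleGraph V}

/-- In a tree, a vertex has at most one neighbor that is closer to a given vertex. -/
theorem eq_of_adj_of_dist_eq_add_one (hT : T.IsTree) {a v u w : V} (hu : T.Adj v u)
    (hw : T.Adj v w) (hdu : T.dist a v = T.dist a u + 1) (hdw : T.dist a v = T.dist a w + 1) :
    u = w := by
  obtain ⟨p, hp, hpl⟩ := hT.connected.exists_path_of_dist a v
  have key : ∀ x, T.Adj v x → T.dist a v = T.dist a x + 1 → x = p.penultimate := by
    intro x hx hdx
    obtain ⟨q, hq, hql⟩ := hT.connected.exists_path_of_dist a x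
    refine hT.isAcyclic.eq_penultimate_of_adj_end hp hx ?_
    refine hT.isAcyclic.mem_support_of_ne_mem_support_of_adj_of_isPath hp hq hx fun hv => ?_
    have h := congrArg Walk.length (hT.isAcyclic.path_concat hp hq hx hv)
    rw [Walk.length_concat] at h
    omega
  rw [key u hu hdu, key w hw hdw]

theorem exists_adj_dist_eq (hT : T.Connected) (a : V) {v : V} {n : ℕ} (h : T.dist a v = n + 1) :
    ∃ u, T.Adj v u ∧ T.dist a u = n := by
  obtain ⟨p, hp⟩ := hT.exists_walk_length_eq_dist v a
  cases p with
  | nil => simp at h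
  | @cons _ u _ h' q =>
    refine ⟨u, h', ?_⟩
    rw [Walk.length_cons, dist_comm] at hp
    have h1 := dist_le q
    rw [dist_comm] at h1
    have h2 := h'.symm.diff_dist_adj (u := a)
    omega

theorem exists_adj_dist_eq_add_one [T.LocallyFinite] (hT : T.IsTree) (a : V) {c : V}
    (hc : 2 ≤ T.degree c) : ∃ x, T.Adj c x ∧ T.dist a x = T.dist a c + 1 := by
  obtain ⟨u, hu, w, hw, huw⟩ := Finset.one_lt_card.mp (show 1 < (T.neighborFinset c).card from hc)
  rw [mem_neighborFinset] at hu hw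
  rcases hT.dist_eq_dist_add_one_of_adj a hu with h | h
  · rcases hT.dist_eq_dist_add_one_of_adj a hw with h' | h'
    · exact absurd (eq_of_adj_of_dist_eq_add_one hT hu hw h h') huw
    · exact ⟨w, hw, h'⟩
  · exact ⟨u, hu, h⟩

/-- In a tree without leaves, every geodesic can be extended by any length. -/
theorem exists_dist_eq_dist_add [T.LocallyFinite] (hT : T.IsTree) (hdeg : ∀ v, 2 ≤ T.degree v)
    (a b : V) (n : ℕ) : ∃ c, T.dist a c = T.dist a b + n ∧ T.dist b c = n := by
  induction n with
  | zero => exact ⟨b, by simp⟩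
  | succ n ih =>
    obtain ⟨c, hac, hbc⟩ := ih
    obtain ⟨x, hx, hax⟩ := exists_adj_dist_eq_add_one hT a (hdeg c)
    refine ⟨x, by omega, ?_⟩
    have h1 := hT.connected.dist_triangle (u := a) (v := b) (w := x)
    have h2 := hT.connected.dist_triangle (u := b) (v := c) (w := x)
    have h3 := dist_eq_one_iff_adj.mpr hx
    omega

theorem infinite_of_isTree [T.LocallyFinite] (hT : T.IsTree) (hdeg : ∀ v, 2 ≤ T.degree v) :
    Infinite V := by
  obtain ⟨a⟩ := hT.connected.nonempty
  choose f _ hf using exists_dist_eq_dist_add hT hdeg a a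
  exact Infinite.of_injective f fun m n h => by rw [← hf m, ← hf n, h]

theorem countable_of_connected [T.LocallyFinite] (hT : T.Connected) : Countable V := by
  obtain ⟨a⟩ := hT.nonempty
  have key : ∀ n, {v | ∃ p : T.Walk v a, p.length = n}.Countable := by
    intro n
    induction n with
    | zero =>
      refine (Set.countable_singleton a).mono ?_
      rintro v ⟨p, hp⟩
      exact Walk.eq_of_length_eq_zero hp
    | succ n ih =>
      refine (ih.biUnion (t := fun v _ => T.neighborSet v) fun v _ =>
        (Set.toFinite (T.neighborSet v)).countable).mono ?_
      rintro v ⟨p, hp⟩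
      cases p with
      | nil => simp at hp
      | cons h q =>
        simp only [Set.mem_iUnion]
        exact ⟨_, ⟨q, by simpa using hp⟩, h.symm⟩
  rw [← Set.countable_univ_iff]
  refine (Set.countable_iUnion key).mono fun v _ => ?_
  obtain ⟨p⟩ := hT v a
  exact Set.mem_iUnion.mpr ⟨p.length, p, rfl⟩

/-- Recursion along a predecessor function that lowers a rank by one. -/
theorem exists_rec_of_rank {S : Type*} {a : V} (d : V → ℕ) (par : V → V)
    (hpar : ∀ v, v ≠ a → d v = d (par v) + 1) (s : S) (step : V → S → S) :
    ∃ F : V → S, F a = s ∧ ∀ v, v ≠ a → F v = step v (F (par v)) := by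
  classical
  -- Recursion on the rank as fuel; `a` is tested at each positive level because `d a` need not be
  -- zero.
  let G : ℕ → V → S := fun n => Nat.rec (fun _ => s)
    (fun _ g v => if v = a then s else step v (g (par v))) n
  refine ⟨fun v => G (d v) v, ?_, fun v hv => ?_⟩
  · show G (d a) a = s
    cases d a with
    | zero => rfl
    | succ n => exact if_pos rfl
  · show G (d v) v = step v (G (d (par v)) (par v))
    rw [hpar v hv]
    exact if_neg hv

/-- The adjacencies are premises of the conclusion so that `e` can be chosen for all quadruples
before the map using it is built. -/
theorem exists_neighborSet_equiv [T.LocallyFinite] {r : ℕ} (hr : T.IsRegularOfDegree r)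
    (p q x y : V) : ∃ e : T.neighborSet p ≃ T.neighborSet x,
      ∀ (hq : T.Adj p q) (_ : T.Adj x y), (e ⟨q, hq⟩ : V) = y := by
  classical
  have hcard : Fintype.card (T.neighborSet p) = Fintype.card (T.neighborSet x) := by
    rw [card_neighborSet_eq_degree, card_neighborSet_eq_degree, hr, hr]
  let e := Fintype.equivOfCardEq hcard
  by_cases h : T.Adj p q ∧ T.Adj x y
  · refine ⟨e.trans (Equiv.swap (e ⟨q, h.1⟩) ⟨y, h.2⟩), fun hq hy => ?_⟩
    simp
  · exact ⟨e, fun hq hy => absurd ⟨hq, hy⟩ h⟩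

/-- A map between vertices of a regular tree that sends `a` to `b` and is a bijection on the
neighborhood of each vertex. -/
theorem exists_local_bijection [T.LocallyFinite] (hT : T.IsTree) {r : ℕ}
    (hr : T.IsRegularOfDegree r) (a b : V) :
    ∃ f : V → V, f a = b ∧ ∀ u, ∃ e : T.neighborSet u ≃ T.neighborSet (f u),
      ∀ v, (e v : V) = f v := by
  classical
  have hex : ∀ v, ∃ u, v ≠ a → T.Adj v u ∧ T.dist a v = T.dist a u + 1 := by
    intro v
    by_cases hv : v = a
    · exact ⟨a, fun h => absurd hv h⟩
    · obtain ⟨n, hn⟩ := Nat.exists_eq_add_one.mpr (hT.connected.pos_dist_of_ne (Ne.symm hv))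
      obtain ⟨u, hvu, hu⟩ := exists_adj_dist_eq hT.connected a hn
      exact ⟨u, fun _ => ⟨hvu, by rw [hn, hu]⟩⟩
  choose par hpar using hex
  choose e he using exists_neighborSet_equiv hr
  let E : V → V → V → V → V → V := fun p q x y v =>
    if h : T.Adj p v then (e p q x y ⟨v, h⟩ : V) else v
  -- The state pairs the image of `v` with that of its predecessor: the bijection at a vertex must
  -- respect the image already given to its predecessor. At the root, `(b, b)` is no edge and
  -- imposes nothing.
  obtain ⟨F, hFa, hF⟩ := exists_rec_of_rank (a := a) (T.dist a) par (fun v hv => (hpar v hv).2)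
    (b, b) (fun v s => (E (par v) (par (par v)) s.1 s.2 v, s.1))
  -- the value at the predecessor, extended to the root
  let g : V → V := fun u => (F u).2
  have hg : ∀ v, v ≠ a → g v = (F (par v)).1 := fun v hv => by
    show (F v).2 = _
    rw [hF v hv]
  have hstep : ∀ v (hv : v ≠ a), (F v).1 =
      e (par v) (par (par v)) (F (par v)).1 (g (par v)) ⟨v, (hpar v hv).1.symm⟩ := by
    intro v hv
    conv_lhs => rw [hF v hv]
    exact dif_pos (hpar v hv).1.symm
  have hadj : ∀ v, v ≠ a → T.Adj (F (par v)).1 (F v).1 := by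
    intro v hv
    rw [hstep v hv]
    exact (e (par v) (par (par v)) (F (par v)).1 (g (par v)) ⟨v, (hpar v hv).1.symm⟩).2
  refine ⟨fun v => (F v).1, congrArg Prod.fst hFa, fun u => ⟨e u (par u) (F u).1 (g u), ?_⟩⟩
  rintro ⟨v, hv⟩
  have hv' : T.Adj u v := hv
  rcases hT.dist_eq_dist_add_one_of_adj a hv' with h | h
  · have hu : u ≠ a := by
      rintro rfl
      simp at h
    have hvp : v = par u := eq_of_adj_of_dist_eq_add_one hT hv' (hpar u hu).1 h (hpar u hu).2
    subst hvp
    rw [he u (par u) (F u).1 (g u) hv' (by rw [hg u hu]; exact (hadj u hu).symm), hg u hu]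
  · have hva : v ≠ a := by
      rintro rfl
      simp at h
    have hup : u = par v :=
      eq_of_adj_of_dist_eq_add_one hT hv'.symm (hpar v hva).1 h (hpar v hva).2
    subst hup
    exact (hstep v hva).symm

/-- Regular trees are vertex-transitive. -/
theorem isVertexTransitive_of_isTree [T.LocallyFinite] (hT : T.IsTree) {r : ℕ}
    (hr : T.IsRegularOfDegree r) : IsVertexTransitive T := by
  intro a b
  obtain ⟨f, hfa, hf⟩ := exists_local_bijection hT hr a b
  have hadj : ∀ {u v}, T.Adj u v → T.Adj (f u) (f v) := by
    intro u v h
    obtain ⟨e, he⟩ := hf u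
    rw [← he ⟨v, h⟩]
    exact (e ⟨v, h⟩).2
  have hinj : ∀ {u v w}, T.Adj u v → T.Adj u w → f v = f w → v = w := by
    intro u v w hv hw h
    obtain ⟨e, he⟩ := hf u
    have : e ⟨v, hv⟩ = e ⟨w, hw⟩ := Subtype.ext (by rw [he, he]; exact h)
    exact congrArg Subtype.val (e.injective this)
  have hsurj : ∀ {u y}, T.Adj (f u) y → ∃ v, T.Adj u v ∧ f v = y := by
    intro u y h
    obtain ⟨e, he⟩ := hf u
    refine ⟨e.symm ⟨y, h⟩, (e.symm ⟨y, h⟩).2, ?_⟩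
    rw [← he, Equiv.apply_symm_apply]
  have hpred := fun v n => exists_adj_dist_eq (v := v) (n := n) hT.connected a
  -- Distances are preserved because `f` cannot fold: if `f v` stepped back towards `b`, it would
  -- equal the image of the predecessor `w` of `u`, against injectivity around `u`.
  have hdist : ∀ n v, T.dist a v = n → T.dist b (f v) = n := by
    intro n
    induction n using Nat.strong_induction_on with
    | _ n ih =>
      intro v hv
      match n, ih, hv with
      | 0, _, hv =>
        rw [← hT.connected.dist_eq_zero_iff.mp hv, hfa, dist_self]
      | m + 1, ih, hv =>
        obtain ⟨u, hvu, hu⟩ := hpred v m hv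
        have hbu := ih m (by omega) u hu
        rcases hT.dist_eq_dist_add_one_of_adj b (hadj hvu) with h | h
        · omega
        · exfalso
          match m, ih, hv, hu, hbu with
          | 0, _, _, _, hbu => omega
          | l + 1, ih, hv, hu, hbu =>
            obtain ⟨w, huw, hw⟩ := hpred u l hu
            have hbw := ih l (by omega) w hw
            have := eq_of_adj_of_dist_eq_add_one hT (hadj hvu).symm (hadj huw) h (by omega)
            rw [hinj hvu.symm huw this] at hv
            omega
  have hinjective : ∀ n v w, T.dist a v = n → f v = f w → v = w := by
    intro n
    induction n with
    | zero =>
      intro v w hv h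
      have hw := hdist _ w rfl
      rw [← h, hdist _ v hv] at hw
      rw [← hT.connected.dist_eq_zero_iff.mp hv, ← hT.connected.dist_eq_zero_iff.mp hw.symm]
    | succ n ih =>
      intro v w hv h
      have hw := hdist _ w rfl
      rw [← h, hdist _ v hv] at hw
      obtain ⟨x, hvx, hx⟩ := hpred v n hv
      obtain ⟨y, hwy, hy⟩ := hpred w n hw.symm
      have hxy : f x = f y := eq_of_adj_of_dist_eq_add_one hT (hadj hvx)
        (h ▸ hadj hwy) (by rw [hdist _ v hv, hdist _ x hx]) (by rw [hdist _ v hv, hdist _ y hy])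
      obtain rfl := ih x y hx hxy
      exact hinj hvx.symm hwy.symm h
  have hsurjective : Function.Surjective f := by
    have key : ∀ y z, T.Walk y z → (∃ u, f u = z) → ∃ u, f u = y := by
      intro y z p hz
      induction p with
      | nil => exact hz
      | cons h _ ih =>
        obtain ⟨u, rfl⟩ := ih hz
        obtain ⟨v, _, hv⟩ := hsurj h.symm
        exact ⟨v, hv⟩
    exact fun y => (hT.connected y b).elim fun p => key y b p ⟨a, hfa⟩
  have hbij : Function.Bijective f := ⟨fun v w h => hinjective _ v w rfl h, hsurjective⟩
  refine ⟨⟨Equiv.ofBijective f hbij, ?_⟩, hfa⟩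
  intro u v
  refine ⟨fun h => ?_, fun h => hadj h⟩
  obtain ⟨w, huw, hw⟩ := hsurj (show T.Adj (f u) (f v) from h)
  rwa [hbij.1 hw] at huw

end Tree

/-! ### Walks in odd cycles -/

section Cycle

open Fin.CommRing

variable {m : ℕ}

theorem cycleGraph_adj_add_one (z : Fin (m + 2)) : (cycleGraph (m + 2)).Adj z (z + 1) :=
  cycleGraph_adj.mpr (Or.inr (add_sub_cancel_left z 1))

theorem cycleGraph_adj_sub_one (z : Fin (m + 2)) : (cycleGraph (m + 2)).Adj z (z - 1) :=
  cycleGraph_adj.mpr (Or.inl (sub_sub_cancel z 1))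

theorem exists_walk_add (z : Fin (m + 2)) (j : ℕ) :
    ∃ p : (cycleGraph (m + 2)).Walk z (z + j), p.length = j := by
  induction j with
  | zero => exact ⟨Walk.nil.copy rfl (by simp), by simp⟩
  | succ j ih =>
    obtain ⟨p, hp⟩ := ih
    exact ⟨(p.concat (cycleGraph_adj_add_one _)).copy rfl (by push_cast; ring), by simp [hp]⟩

theorem exists_walk_sub (z : Fin (m + 2)) (j : ℕ) :
    ∃ p : (cycleGraph (m + 2)).Walk z (z - j), p.length = j := by
  induction j with
  | zero => exact ⟨Walk.nil.copy rfl (by simp), by simp⟩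
  | succ j ih =>
    obtain ⟨p, hp⟩ := ih
    exact ⟨(p.concat (cycleGraph_adj_sub_one _)).copy rfl (by push_cast; ring), by simp [hp]⟩

theorem exists_two_mul_eq_one (hm : Odd (m + 2)) : ∃ h : Fin (m + 2), 2 * h = 1 := by
  obtain ⟨h, hh⟩ := hm
  refine ⟨((h + 1 : ℕ) : Fin (m + 2)), ?_⟩
  have h0 : ((m + 2 : ℕ) : Fin (m + 2)) = 0 := Fin.natCast_self _
  have h1 : ((2 * (h + 1) : ℕ) : Fin (m + 2)) = ((m + 2 : ℕ) : Fin (m + 2)) + 1 := by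
    rw [show 2 * (h + 1) = (m + 2) + 1 by omega, Nat.cast_add, Nat.cast_one]
  rw [h0, zero_add] at h1
  exact_mod_cast h1

/-- In an odd cycle of length `k`, any two vertices are joined by walks of each length `n ≥ k`. -/
theorem exists_walk_length_eq_of_odd (hm : Odd (m + 2)) {n : ℕ} (hn : m + 2 ≤ n)
    (z w : Fin (m + 2)) : ∃ p : (cycleGraph (m + 2)).Walk z w, p.length = n := by
  obtain ⟨h, hh⟩ := exists_two_mul_eq_one hm
  -- With `j` steps forward and `n - j` back, the displacement is `2 * j - n`; solve for `w - z`,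
  -- with `h` the inverse of 2.
  let j : Fin (m + 2) := h * (w - z + n)
  have hj : (j : ℕ) ≤ n := j.2.le.trans hn
  obtain ⟨p, hp⟩ := exists_walk_add z (j : ℕ)
  obtain ⟨q, hq⟩ := exists_walk_sub (z + ((j : ℕ) : Fin (m + 2))) (n - j)
  refine ⟨(p.append q).copy rfl ?_, by
    rw [Walk.length_copy, Walk.length_append, hp, hq, Nat.add_sub_cancel' hj]⟩
  rw [Nat.cast_sub hj, Fin.cast_val_eq_self]
  linear_combination (w - z + n) * hh

/-- Otherwise `x = z + 2 = z - 2`, so `4 = 0`, although 2 is invertible modulo an odd number. -/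
theorem eq_of_cycleGraph_adj (hm : Odd (m + 2)) {x z : Fin (m + 2)}
    (h1 : (cycleGraph (m + 2)).Adj x (z + 1)) (h2 : (cycleGraph (m + 2)).Adj x (z - 1)) :
    x = z := by
  obtain ⟨h, hh⟩ := exists_two_mul_eq_one hm
  rw [cycleGraph_adj] at h1 h2
  rcases h1 with h1 | h1
  · rcases h2 with h2 | h2
    · linear_combination h2
    · have h4 : (1 : Fin (m + 2)) = 0 := by
        linear_combination - h ^ 2 * (h1 + h2) - (2 * h + 1) * hh
      exact absurd h4 one_ne_zero
  · linear_combination - h1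

end Cycle

/-! ### Distances, spheres and motion in the product -/

section Product

variable {V : Type*} {T : SimpleGraph V}

theorem exists_walk_directProduct {V W : Type*} {G : SimpleGraph V} {H : SimpleGraph W} {a b : V}
    {z w : W} (p : G.Walk a b) (q : H.Walk z w) (h : p.length = q.length) :
    ∃ s : (directProduct G H).Walk (a, z) (b, w), s.length = p.length := by
  induction p generalizing z with
  | nil =>
    cases q with
    | nil => exact ⟨Walk.nil, rfl⟩
    | cons _ _ => simp at h
  | @cons a c b hac p ih =>
    cases q with
    | nil => simp at h
    | @cons _ x _ hzx q =>
      obtain ⟨s, hs⟩ := ih q (by simpa using h)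
      have hadj : (directProduct G H).Adj (a, z) (c, x) := ⟨hac, hzx⟩
      exact ⟨Walk.cons hadj s, by simp [hs]⟩

theorem dist_fst_le_length {V W : Type*} {G : SimpleGraph V} {H : SimpleGraph W} {x y : V × W}
    (p : (directProduct G H).Walk x y) : G.dist x.1 y.1 ≤ p.length := by
  let f : directProduct G H →g G := ⟨Prod.fst, fun h => h.1⟩
  have := dist_le (p.map f)
  rwa [Walk.length_map] at this

theorem exists_walk_length_eq_dist_add (hT : T.Connected) (hne : ∀ v, ∃ w, T.Adj v w) (a b : V)
    (i : ℕ) : ∃ p : T.Walk a b, p.length = T.dist a b + 2 * i := by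
  induction i with
  | zero => exact hT.exists_walk_length_eq_dist a b
  | succ i ih =>
    obtain ⟨p, hp⟩ := ih
    obtain ⟨x, hx⟩ := hne a
    exact ⟨Walk.cons hx (Walk.cons hx.symm p), by simp only [Walk.length_cons, hp]; ring⟩

variable {k : ℕ}

theorem exists_walk_length_eq_cycleGraph (hk : 2 ≤ k) (hodd : Odd k) {n : ℕ} (hn : k ≤ n)
    (z w : Fin k) : ∃ p : (cycleGraph k).Walk z w, p.length = n := by
  obtain ⟨m, rfl⟩ := Nat.exists_eq_add_of_le' hk
  exact exists_walk_length_eq_of_odd hodd hn z w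

theorem exists_walk_directProduct_cycleGraph (hT : T.Connected) (hne : ∀ v, ∃ w, T.Adj v w)
    (hk : 2 ≤ k) (hodd : Odd k) (a b : V) (z w : Fin k) {i : ℕ} (hi : k ≤ T.dist a b + 2 * i) :
    ∃ s : (directProduct T (cycleGraph k)).Walk (a, z) (b, w), s.length = T.dist a b + 2 * i := by
  obtain ⟨p, hp⟩ := exists_walk_length_eq_dist_add hT hne a b i
  obtain ⟨q, hq⟩ := exists_walk_length_eq_cycleGraph hk hodd hi z w
  obtain ⟨s, hs⟩ := exists_walk_directProduct p q (hp.trans hq.symm)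
  exact ⟨s, hs.trans hp⟩

theorem connected_directProduct_cycleGraph (hT : T.Connected) (hne : ∀ v, ∃ w, T.Adj v w)
    (hk : 2 ≤ k) (hodd : Odd k) : (directProduct T (cycleGraph k)).Connected := by
  have : Nonempty (V × Fin k) := ⟨(hT.nonempty.some, ⟨0, by omega⟩)⟩
  refine ⟨fun x y => ?_⟩
  obtain ⟨s, -⟩ := exists_walk_directProduct_cycleGraph hT hne hk hodd x.1 y.1 x.2 y.2
    (i := k) (by omega)
  exact ⟨s⟩

theorem dist_directProduct_eq (hT : T.Connected) (hne : ∀ v, ∃ w, T.Adj v w)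
    (hk : 2 ≤ k) (hodd : Odd k) {a b : V} (hab : k ≤ T.dist a b) (z w : Fin k) :
    (directProduct T (cycleGraph k)).dist (a, z) (b, w) = T.dist a b := by
  obtain ⟨s, hs⟩ := exists_walk_directProduct_cycleGraph hT hne hk hodd a b z w (i := 0) (by omega)
  obtain ⟨t, ht⟩ := (connected_directProduct_cycleGraph hT hne hk hodd).exists_walk_length_eq_dist
    (a, z) (b, w)
  refine le_antisymm ((dist_le s).trans hs.le) ?_
  rw [← ht]
  exact dist_fst_le_length t

theorem dist_directProduct_le (hT : T.Connected) (hne : ∀ v, ∃ w, T.Adj v w)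
    (hk : 2 ≤ k) (hodd : Odd k) {a b : V} (hab : T.dist a b < k) (z w : Fin k) :
    (directProduct T (cycleGraph k)).dist (a, z) (b, w) ≤ k + 1 := by
  -- Backtracking fixes parity, so this `i` makes the length `k` or `k + 1`.
  obtain ⟨s, hs⟩ := exists_walk_directProduct_cycleGraph hT hne hk hodd a b z w
    (i := (k - T.dist a b + 1) / 2) (by omega)
  have := dist_le s
  omega

theorem sphere_directProduct_eq (hT : T.Connected) (hne : ∀ v, ∃ w, T.Adj v w)
    (hk : 2 ≤ k) (hodd : Odd k) (b : V) (z w : Fin k) {n : ℕ} (hn : k + 1 < n) :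
    sphere (directProduct T (cycleGraph k)) (b, z) n =
      sphere (directProduct T (cycleGraph k)) (b, w) n := by
  ext ⟨c, x⟩
  simp only [sphere, Set.mem_ofPred_eq]
  rcases le_or_gt k (T.dist b c) with h | h
  · rw [dist_directProduct_eq hT hne hk hodd h, dist_directProduct_eq hT hne hk hodd h]
  · have h1 := dist_directProduct_le hT hne hk hodd h z x
    have h2 := dist_directProduct_le hT hne hk hodd h w x
    omega

theorem exists_adj_of_two_le_degree [T.LocallyFinite] (hdeg : ∀ v, 2 ≤ T.degree v) (v : V) :
    ∃ w, T.Adj v w := by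
  obtain ⟨w, hw⟩ := (T.degree_pos_iff_exists_adj v).mp (by have := hdeg v; omega)
  exact ⟨w, hw⟩

theorem not_dsc_directProduct [T.LocallyFinite] (hT : T.IsTree) (hdeg : ∀ v, 2 ≤ T.degree v)
    (hk : 2 ≤ k) (hodd : Odd k) : ¬ DSC (directProduct T (cycleGraph k)) := by
  have hne := exists_adj_of_two_le_degree hdeg
  rintro ⟨⟨a, x⟩, h⟩
  -- At tree distance `k` all vertices over `b` are equidistant from `(a, x)`.
  obtain ⟨b, hab, -⟩ := exists_dist_eq_dist_add hT hdeg a a k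
  rw [dist_self, zero_add] at hab
  let z : Fin k := ⟨0, by omega⟩
  let w : Fin k := ⟨1, by omega⟩
  have hzw : z ≠ w := by simp [z, w]
  refine h (b, z) (b, w) (fun e => hzw (congrArg Prod.snd e)) ?_
    ((Set.finite_le_nat (k + 1)).subset fun n hn => ?_)
  · rw [dist_directProduct_eq hT.connected hne hk hodd hab.ge,
      dist_directProduct_eq hT.connected hne hk hodd hab.ge]
  · by_contra hlt
    exact hn (sphere_directProduct_eq hT.connected hne hk hodd b z w (not_le.mp hlt))

theorem exists_unique_common_neighbor (hk : 2 ≤ k) (hodd : Odd k) (z : Fin k) :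
    ∃ x y : Fin k, (cycleGraph k).Adj z x ∧ (cycleGraph k).Adj z y ∧
      ∀ w, (cycleGraph k).Adj w x → (cycleGraph k).Adj w y → w = z := by
  obtain ⟨m, rfl⟩ := Nat.exists_eq_add_of_le' hk
  exact ⟨z + 1, z - 1, cycleGraph_adj_add_one z, cycleGraph_adj_sub_one z,
    fun w => eq_of_cycleGraph_adj hodd⟩

theorem hasInfiniteMotion_directProduct [T.LocallyFinite] (hT : T.IsTree)
    (hdeg : ∀ v, 2 ≤ T.degree v) (hk : 2 ≤ k) (hodd : Odd k) :
    HasInfiniteMotion (directProduct T (cycleGraph k)) := by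
  rintro g ⟨v, hv⟩ hfin
  obtain ⟨o⟩ := hT.connected.nonempty
  -- Take a moved vertex whose tree coordinate is farthest from the root `o`.
  obtain ⟨⟨a, z⟩, haz, hmax⟩ :=
    Set.exists_max_image _ (fun x : V × Fin k => T.dist o x.1)
      (Set.not_infinite.mp fun h => h hfin) ⟨v, hv⟩
  have hfix : ∀ b x, T.dist o a < T.dist o b → g (b, x) = (b, x) := by
    intro b x hb
    by_contra hne
    exact absurd (hmax (b, x) hne) (not_le.mpr hb)
  obtain ⟨b, hab, hb⟩ := exists_adj_dist_eq_add_one hT o (hdeg a)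
  obtain ⟨x, y, hx, hy, hxy⟩ := exists_unique_common_neighbor hk hodd z
  have hgx : (directProduct T (cycleGraph k)).Adj (g (a, z)) (b, x) := by
    rw [← hfix b x (by omega)]
    exact g.map_adj_iff.mpr ⟨hab, hx⟩
  have hgy : (directProduct T (cycleGraph k)).Adj (g (a, z)) (b, y) := by
    rw [← hfix b y (by omega)]
    exact g.map_adj_iff.mpr ⟨hab, hy⟩
  have hz : (g (a, z)).2 = z := hxy _ hgx.2 hgy.2
  have hne : (g (a, z)).1 ≠ a := fun h => haz (Prod.ext h hz)
  have hcb : T.Adj b (g (a, z)).1 := hgx.1.symm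
  -- The image lies over a neighbor of `b`: either the predecessor `a`, or a vertex beyond `b`,
  -- where `g` is the identity and injectivity applies.
  rcases hT.dist_eq_dist_add_one_of_adj o hcb with h | h
  · exact hne (eq_of_adj_of_dist_eq_add_one hT hcb hab.symm h hb)
  · have h1 := hfix (g (a, z)).1 (g (a, z)).2 (by omega)
    exact hne (congrArg Prod.fst (g.injective h1))

theorem isVertexTransitive_directProduct {V W : Type*} {G : SimpleGraph V} {H : SimpleGraph W}
    (hG : IsVertexTransitive G) (hH : IsVertexTransitive H) :
    IsVertexTransitive (directProduct G H) := by
  rintro ⟨a, z⟩ ⟨b, w⟩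
  obtain ⟨g, hg⟩ := hG a b
  obtain ⟨h, hh⟩ := hH z w
  exact ⟨⟨g.toEquiv.prodCongr h.toEquiv, and_congr g.map_adj_iff h.map_adj_iff⟩,
    Prod.ext hg hh⟩

theorem isVertexTransitive_cycleGraph (hk : 2 ≤ k) : IsVertexTransitive (cycleGraph k) := by
  obtain ⟨m, rfl⟩ := Nat.exists_eq_add_of_le' hk
  intro a b
  refine ⟨⟨Equiv.addRight (b - a), ?_⟩, add_sub_cancel a b⟩
  intro x y
  simp [cycleGraph_adj]

end Product

/-! ### Walk counts and generic colorings -/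

section AdjacencyOperator

variable {V W : Type*}

/-- The adjacency operator of a locally finite graph. -/
noncomputable def adjOp (G : SimpleGraph V) [G.LocallyFinite] : (V → ℚ) →ₗ[ℚ] (V → ℚ) where
  toFun f v := ∑ x ∈ G.neighborFinset v, f x
  map_add' _ _ := funext fun _ => Finset.sum_add_distrib
  map_smul' _ _ := funext fun _ => (Finset.mul_sum _ _ _).symm

theorem adjOp_apply (G : SimpleGraph V) [G.LocallyFinite] (f : V → ℚ) (v : V) :
    adjOp G f v = ∑ x ∈ G.neighborFinset v, f x := rfl

theorem adjOp_comp_iso (G : SimpleGraph V) [G.LocallyFinite] (g : G ≃g G) (f : V → ℚ) :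
    adjOp G (f ∘ g) = adjOp G f ∘ g := by
  funext v
  exact Finset.sum_equiv g.toEquiv (fun w => by simpa using g.map_adj_iff.symm) fun _ _ => rfl

theorem adjOp_pow_comp_iso (G : SimpleGraph V) [G.LocallyFinite] (g : G ≃g G) (n : ℕ)
    (f : V → ℚ) : (adjOp G ^ n) (f ∘ g) = (adjOp G ^ n) f ∘ g := by
  induction n with
  | zero => rfl
  | succ n ih => rw [pow_succ', Module.End.mul_apply, ih, adjOp_comp_iso, Module.End.mul_apply]

theorem continuous_adjOp_pow (G : SimpleGraph V) [G.LocallyFinite] (n : ℕ) :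
    Continuous (adjOp G ^ n : (V → ℚ) →ₗ[ℚ] (V → ℚ)) := by
  have h1 : Continuous (adjOp G) :=
    continuous_pi fun v => continuous_finsetSum _ fun x _ => continuous_apply x
  induction n with
  | zero => exact continuous_id
  | succ n ih =>
    rw [pow_succ']
    exact h1.comp ih

/-- If any two vertices see infinitely many vertices through different numbers of walks of some
length, then two colors suffice to break all automorphisms: for a generic coloring, the vertices
are told apart by the numbers of walks that end in a vertex of color `1`. -/
theorem exists_isDistinguishingColoring [Countable V] (G : SimpleGraph V) [G.LocallyFinite]
    [DecidableEq V]
    (hsep : ∀ u v, u ≠ v → ∀ I : Finset V, ∃ x ∉ I, ∃ n,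
      (adjOp G ^ n) (Pi.single x 1) u ≠ (adjOp G ^ n) (Pi.single x 1) v) :
    ∃ f : V → Fin 2, IsDistinguishingColoring G f := by
  let val : (V → Fin 2) → V → ℚ := fun f v => ((f v : ℕ) : ℚ)
  have hval : Continuous val := continuous_pi fun v =>
    (continuous_of_discreteTopology (f := fun i : Fin 2 => ((i : ℕ) : ℚ))).comp (continuous_apply v)
  let U : {p : V × V // p.1 ≠ p.2} → Set (V → Fin 2) := fun p =>
    {f | ∃ n, (adjOp G ^ n) (val f) p.1.1 ≠ (adjOp G ^ n) (val f) p.1.2}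
  have hopen : ∀ p, IsOpen (U p) := by
    intro p
    have : U p = ⋃ n, {f | (adjOp G ^ n) (val f) p.1.1 ≠ (adjOp G ^ n) (val f) p.1.2} := by
      ext f
      simp [U]
    rw [this]
    refine isOpen_iUnion fun n => ?_
    have hc := (continuous_adjOp_pow G n).comp hval
    exact isOpen_ne_fun ((continuous_apply p.1.1).comp hc) ((continuous_apply p.1.2).comp hc)
  have hdense : ∀ p, Dense (U p) := by
    intro p
    rw [dense_iff_inter_open]
    rintro O hO ⟨f, hf⟩
    obtain ⟨I, s, hs, hsO⟩ := isOpen_pi_iff.mp hO f hf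
    obtain ⟨x, hx, n, hn⟩ := hsep p.1.1 p.1.2 p.2 I
    obtain ⟨i, hi⟩ := exists_ne (f x)
    -- Recoloring `x` adds a nonzero multiple of the walk counts to `x`, which differ at the two
    -- vertices; so `f` and `f'` cannot both lie outside `U p`.
    let f' := Function.update f x i
    have hf' : f' ∈ O := hsO fun j hj => by
      have hjx : j ≠ x := fun e => hx (e ▸ hj)
      rw [show f' j = f j from Function.update_of_ne hjx _ _]
      exact (hs j hj).2
    by_contra hempty
    have h1 : f ∉ U p := fun h => hempty ⟨f, hf, h⟩
    have h2 : f' ∉ U p := fun h => hempty ⟨f', hf', h⟩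
    have h1' := not_not.mp (not_exists.mp h1 n)
    have h2' := not_not.mp (not_exists.mp h2 n)
    have hv : val f' = val f + (((i : ℕ) : ℚ) - ((f x : ℕ) : ℚ)) • Pi.single x 1 := by
      funext j
      by_cases hj : j = x
      · subst hj
        simp [val, f']
      · simp [val, f', hj]
    have hc : ((i : ℕ) : ℚ) - ((f x : ℕ) : ℚ) ≠ 0 := by
      rw [sub_ne_zero]
      exact fun h => hi (Fin.ext (Nat.cast_injective h))
    rw [hv, map_add, map_smul] at h2'
    simp only [Pi.add_apply, Pi.smul_apply, smul_eq_mul] at h2'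
    rw [h1', add_right_inj] at h2'
    exact hn (mul_left_cancel₀ hc h2')
  obtain ⟨f, hf⟩ := (dense_iInter_of_isOpen hopen hdense).nonempty
  refine ⟨f, fun g hg v => ?_⟩
  by_contra hne
  obtain ⟨n, hn⟩ := Set.mem_iInter.mp hf ⟨(g v, v), hne⟩
  have hvg : val f ∘ g = val f := funext fun w => congrArg (fun i : Fin 2 => ((i : ℕ) : ℚ)) (hg w)
  refine hn ?_
  have := congrFun (adjOp_pow_comp_iso G g n (val f)) v
  rw [hvg] at this
  exact this.symm

theorem adjOp_pow_directProduct (G : SimpleGraph V) (H : SimpleGraph W) [G.LocallyFinite]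
    [H.LocallyFinite] [(directProduct G H).LocallyFinite] (n : ℕ) (p : V → ℚ) (q : W → ℚ) :
    (adjOp (directProduct G H) ^ n) (fun x => p x.1 * q x.2) =
      fun x => (adjOp G ^ n) p x.1 * (adjOp H ^ n) q x.2 := by
  induction n with
  | zero => rfl
  | succ n ih =>
    funext x
    rw [pow_succ', Module.End.mul_apply, ih, pow_succ', pow_succ', Module.End.mul_apply,
      Module.End.mul_apply]
    simp only [adjOp_apply]
    rw [Finset.sum_mul_sum, ← Finset.sum_product']
    refine Finset.sum_congr ?_ fun _ _ => rfl
    ext y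
    rw [mem_neighborFinset, Finset.mem_product, mem_neighborFinset, mem_neighborFinset]
    rfl

theorem adjOp_pow_single_nonneg [DecidableEq V] (G : SimpleGraph V) [G.LocallyFinite] (c : V)
    (n : ℕ) (b : V) : 0 ≤ (adjOp G ^ n) (Pi.single c 1) b := by
  induction n generalizing b with
  | zero =>
    rw [pow_zero, Module.End.one_apply, Pi.single_apply]
    split_ifs <;> norm_num
  | succ n ih =>
    rw [pow_succ', Module.End.mul_apply, adjOp_apply]
    exact Finset.sum_nonneg fun x _ => ih x

theorem adjOp_pow_single_eq_zero [DecidableEq V] (G : SimpleGraph V) [G.LocallyFinite] (c : V)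
    {n : ℕ} {b : V} (h : ∀ p : G.Walk b c, p.length ≠ n) :
    (adjOp G ^ n) (Pi.single c 1) b = 0 := by
  induction n generalizing b with
  | zero =>
    rw [pow_zero, Module.End.one_apply, Pi.single_apply, if_neg]
    rintro rfl
    exact h Walk.nil rfl
  | succ n ih =>
    rw [pow_succ', Module.End.mul_apply, adjOp_apply]
    refine Finset.sum_eq_zero fun x hx => ih fun p hp => ?_
    exact h (Walk.cons ((mem_neighborFinset _ _ _).mp hx) p) (by simp [hp])

theorem adjOp_pow_single_pos [DecidableEq V] (G : SimpleGraph V) [G.LocallyFinite] {b c : V}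
    (p : G.Walk b c) : 0 < (adjOp G ^ p.length) (Pi.single c 1) b := by
  induction p with
  | nil => simp
  | cons h p ih =>
    rw [Walk.length_cons, pow_succ', Module.End.mul_apply, adjOp_apply]
    exact Finset.sum_pos' (fun x _ => adjOp_pow_single_nonneg G _ _ x)
      ⟨_, (mem_neighborFinset _ _ _).mpr h, ih⟩

end AdjacencyOperator

/-! ### Invertibility on odd cycles, and separation in the product -/

section OddCycle

open Fin.CommRing

/-- A kernel element changes sign under a shift by 2; an odd number `m + 2` of such shifts returns
to the start, so it equals its own negative. -/
theorem adjOp_cycleGraph_injective {m : ℕ} (hm : Odd (m + 2)) [(cycleGraph (m + 2)).LocallyFinite] :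
    Function.Injective (adjOp (cycleGraph (m + 2))) := by
  rw [← LinearMap.ker_eq_bot, LinearMap.ker_eq_bot']
  intro q hq
  obtain ⟨h, hh⟩ := exists_two_mul_eq_one hm
  have hnext : ∀ z, q (z + 2) = - q z := by
    intro z
    have h0 := congrFun hq (z + 1)
    have hset : (cycleGraph (m + 2)).neighborFinset (z + 1) = {z, z + 2} := by
      ext w
      rw [mem_neighborFinset, cycleGraph_adj, Finset.mem_insert, Finset.mem_singleton]
      refine or_congr ⟨fun h => ?_, ?_⟩ ⟨fun h => ?_, ?_⟩
      · linear_combination - h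
      · rintro rfl
        ring
      · linear_combination h
      · rintro rfl
        ring
    have hne : z ≠ z + 2 := fun h2 =>
      absurd (show (1 : Fin (m + 2)) = 0 by linear_combination - h * h2 - hh) one_ne_zero
    rw [adjOp_apply, hset, Finset.sum_pair hne, Pi.zero_apply] at h0
    linarith
  have hiter : ∀ (j : ℕ) z, q (z + 2 * j) = (-1) ^ j * q z := by
    intro j z
    induction j with
    | zero => simp
    | succ j ih =>
      rw [show z + 2 * ((j + 1 : ℕ) : Fin (m + 2)) = z + 2 * j + 2 by push_cast; ring, hnext, ih,
        pow_succ]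
      ring
  funext z
  have h1 := hiter (m + 2) z
  rw [Fin.natCast_self, mul_zero, add_zero, hm.neg_one_pow] at h1
  rw [Pi.zero_apply]
  linarith

end OddCycle

theorem adjOp_pow_cycleGraph_surjective {k : ℕ} (hk : 2 ≤ k) (hodd : Odd k)
    [(cycleGraph k).LocallyFinite] (n : ℕ) :
    Function.Surjective (adjOp (cycleGraph k) ^ n : (Fin k → ℚ) →ₗ[ℚ] (Fin k → ℚ)) := by
  obtain ⟨m, rfl⟩ := Nat.exists_eq_add_of_le' hk
  rw [Module.End.coe_pow]
  exact (LinearMap.injective_iff_surjective.mp (adjOp_cycleGraph_injective hodd)).iterate n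

theorem exists_apply_single_ne_zero {ι : Type*} [Fintype ι] [DecidableEq ι]
    (φ : (ι → ℚ) →ₗ[ℚ] ℚ) {q : ι → ℚ} (hq : φ q ≠ 0) : ∃ i, φ (Pi.single i 1) ≠ 0 := by
  by_contra! h
  refine hq ?_
  rw [LinearMap.pi_apply_eq_sum_univ]
  refine Finset.sum_eq_zero fun i _ => ?_
  rw [show (fun j => if i = j then (1 : ℚ) else 0) = Pi.single i 1 by
    funext j; simp [Pi.single_apply, eq_comm], h i, smul_zero]

/-- By surjectivity some `q` is sent to the indicator of `z`, where the functional is 1, so it is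
nonzero on a basis vector. Used with `t = 1` over one tree vertex and `t = 0` over two. -/
theorem exists_adjOp_pow_cycleGraph_ne {k : ℕ} (hk : 2 ≤ k) (hodd : Odd k)
    [(cycleGraph k).LocallyFinite] (n : ℕ) (z w : Fin k) (t : ℚ) (h : t = 0 ∨ z ≠ w) :
    ∃ x, (adjOp (cycleGraph k) ^ n) (Pi.single x 1) z ≠
      t * (adjOp (cycleGraph k) ^ n) (Pi.single x 1) w := by
  obtain ⟨q, hq⟩ := adjOp_pow_cycleGraph_surjective hk hodd n (Pi.single z 1)
  let φ : (Fin k → ℚ) →ₗ[ℚ] ℚ :=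
    (LinearMap.proj z - t • LinearMap.proj w) ∘ₗ (adjOp (cycleGraph k) ^ n)
  have hφ : ∀ p, φ p = (adjOp (cycleGraph k) ^ n) p z - t * (adjOp (cycleGraph k) ^ n) p w :=
    fun p => rfl
  obtain ⟨x, hx⟩ := exists_apply_single_ne_zero φ (q := q) (by
    rw [hφ, hq, Pi.single_eq_same]
    rcases h with rfl | h
    · simp
    · rw [Pi.single_eq_of_ne h.symm]
      simp)
  exact ⟨x, sub_ne_zero.mp hx⟩

theorem isDistinguishable_directProduct {V : Type*} {T : SimpleGraph V} [T.LocallyFinite]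
    (hT : T.IsTree) (hdeg : ∀ v, 2 ≤ T.degree v) {k : ℕ} (hk : 2 ≤ k) (hodd : Odd k) :
    IsDistinguishable 2 (directProduct T (cycleGraph k)) := by
  classical
  have := countable_of_connected hT.connected
  let inst : (directProduct T (cycleGraph k)).LocallyFinite := fun x =>
    (((T.neighborFinset x.1) ×ˢ ((cycleGraph k).neighborFinset x.2)).finite_toSet.subset (by
      rintro y ⟨h1, h2⟩
      simpa using And.intro h1 h2)).fintype
  rw [isDistinguishable_iff]
  refine exists_isDistinguishingColoring _ ?_
  rintro ⟨b, z⟩ ⟨b', z'⟩ hne I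
  -- `c` lies beyond `b` as seen from `b'`, too far out for `I` to meet its fiber. If `b ≠ b'`,
  -- walks of length `N` reach `c` from `b` but not from `b'`.
  let N := I.sup (fun x => T.dist b x.1) + 1
  obtain ⟨c, hc', hc⟩ := exists_dist_eq_dist_add hT hdeg b' b N
  have hI : ∀ x, (c, x) ∉ I := by
    intro x hx
    have := Finset.le_sup (f := fun x : V × Fin k => T.dist b x.1) hx
    simp only [hc, N] at this
    omega
  have hsingle : ∀ x : Fin k, (Pi.single (c, x) 1 : V × Fin k → ℚ) =
      fun y => (Pi.single c 1 : V → ℚ) y.1 * (Pi.single x 1 : Fin k → ℚ) y.2 := by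
    intro x
    funext y
    simp only [Pi.single_apply, Prod.ext_iff, mul_ite, mul_one, mul_zero]
    split_ifs <;> simp_all
  obtain ⟨p, hp⟩ := hT.connected.exists_walk_length_eq_dist b c
  have hpos := adjOp_pow_single_pos T p
  rw [hp, hc] at hpos
  by_cases hb : b = b'
  · subst hb
    obtain ⟨x, hx⟩ := exists_adjOp_pow_cycleGraph_ne hk hodd N z z' 1
      (Or.inr fun h => hne (by rw [h]))
    refine ⟨(c, x), hI x, N, ?_⟩
    rw [hsingle, adjOp_pow_directProduct]
    rw [one_mul] at hx
    exact fun h => hx (mul_left_cancel₀ hpos.ne' h)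
  · obtain ⟨x, hx⟩ := exists_adjOp_pow_cycleGraph_ne hk hodd N z z' 0 (Or.inl rfl)
    refine ⟨(c, x), hI x, N, ?_⟩
    have hzero : (adjOp T ^ N) (Pi.single c 1) b' = 0 := by
      refine adjOp_pow_single_eq_zero T c fun s hs => ?_
      have h1 := dist_le s
      have h2 := hT.connected.pos_dist_of_ne (Ne.symm hb)
      omega
    rw [hsingle, adjOp_pow_directProduct]
    simp only [hzero, zero_mul]
    rw [zero_mul] at hx
    exact mul_ne_zero hpos.ne' hx

/-! ### A concrete 2-valent tree and the main theorem -/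

/-- The two-way infinite path. -/
def intPath : SimpleGraph ℤ where
  Adj x y := y = x + 1 ∨ x = y + 1
  symm := ⟨fun _ _ h => h.symm⟩
  loopless := ⟨fun x h => by omega⟩

theorem isTree_intPath : intPath.IsTree := by
  refine ⟨?_, isAcyclic_iff_forall_adj_isBridge.mpr ?_⟩
  · have key : ∀ x : ℤ, intPath.Reachable 0 x := by
      intro x
      induction x using Int.induction_on with
      | zero => exact Reachable.refl _
      | succ i ih => exact ih.trans (Adj.reachable (Or.inl rfl))
      | pred i ih => exact ih.trans (Adj.reachable (Or.inr (by ring)))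
    have : Nonempty ℤ := ⟨0⟩
    exact ⟨fun x y => (key x).symm.trans (key y)⟩
  -- Without the edge from `x` to `x + 1`, no walk leaves the half-line up to `x`.
  · have key : ∀ x, ¬ (intPath.deleteEdges {s(x, x + 1)}).Reachable x (x + 1) := by
      rintro x ⟨p⟩
      have : ∀ y z, (intPath.deleteEdges {s(x, x + 1)}).Walk y z → y ≤ x → z ≤ x := by
        intro y z p
        induction p with
        | nil => exact id
        | @cons y w _ h _ ih =>
          intro hy
          refine ih ?_
          rw [deleteEdges_adj] at h
          obtain ⟨h1, h2⟩ := h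
          rcases h1 with h1 | h1
          · by_contra hlt
            refine h2 ?_
            rw [Set.mem_singleton_iff, h1, show x = y by omega]
          · omega
      have := this _ _ p le_rfl
      omega
    intro v w h
    rw [isBridge_iff]
    rcases h with rfl | rfl
    · exact key v
    · rw [Sym2.eq_swap]
      exact fun h => key w h.symm

noncomputable instance : intPath.LocallyFinite := fun x =>
  ((({x - 1, x + 1} : Finset ℤ)).finite_toSet.subset (by
    intro y hy
    have hy' : y = x + 1 ∨ x = y + 1 := hy
    rw [Finset.mem_coe, Finset.mem_insert, Finset.mem_singleton]
    omega)).fintype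

theorem isRegularOfDegree_intPath : intPath.IsRegularOfDegree 2 := by
  intro x
  have : intPath.neighborFinset x = {x - 1, x + 1} := by
    ext y
    rw [mem_neighborFinset, Finset.mem_insert, Finset.mem_singleton]
    show y = x + 1 ∨ x = y + 1 ↔ _
    omega
  rw [SimpleGraph.degree, this, Finset.card_pair (by omega)]

theorem directProduct_tree_cycleGraph {V : Type*} (T : SimpleGraph V) [T.LocallyFinite] (r k : ℕ)
    (hr : 2 ≤ r) (hT : T.IsTree) (hreg : T.IsRegularOfDegree r) (hk : 7 ≤ k) (hodd : Odd k) :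
    (directProduct T (cycleGraph k)).Connected ∧ Countable (V × Fin k) ∧ Infinite (V × Fin k) ∧
      IsVertexTransitive (directProduct T (cycleGraph k)) ∧
      ¬ DSC (directProduct T (cycleGraph k)) ∧
      IsDistinguishable 2 (directProduct T (cycleGraph k)) ∧
      HasInfiniteMotion (directProduct T (cycleGraph k)) := by
  have hdeg : ∀ v, 2 ≤ T.degree v := fun v => (hreg v).symm ▸ hr
  have hk2 : 2 ≤ k := by omega
  have := countable_of_connected hT.connected
  have := infinite_of_isTree hT hdeg
  have : Nonempty (Fin k) := ⟨⟨0, by omega⟩⟩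
  exact ⟨connected_directProduct_cycleGraph hT.connected (exists_adj_of_two_le_degree hdeg) hk2 hodd,
    inferInstance, inferInstance,
    isVertexTransitive_directProduct (isVertexTransitive_of_isTree hT hreg)
      (isVertexTransitive_cycleGraph hk2),
    not_dsc_directProduct hT hdeg hk2 hodd, isDistinguishable_directProduct hT hdeg hk2 hodd,
    hasInfiniteMotion_directProduct hT hdeg hk2 hodd⟩

end DistinctSpheres

theorem mainTheorem10 :
    (∀ (V : Type*) (T : SimpleGraph V) [T.LocallyFinite] (r k : ℕ),
      2 ≤ r → T.IsTree → T.IsRegularOfDegree r → 7 ≤ k → Odd k →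
        (DistinctSpheres.directProduct T (SimpleGraph.cycleGraph k)).Connected ∧ Countable (V × Fin k) ∧ Infinite (V × Fin k) ∧
          DistinctSpheres.IsVertexTransitive (DistinctSpheres.directProduct T (SimpleGraph.cycleGraph k)) ∧
          ¬ DistinctSpheres.DSC (DistinctSpheres.directProduct T (SimpleGraph.cycleGraph k)) ∧
          DistinctSpheres.IsDistinguishable 2 (DistinctSpheres.directProduct T (SimpleGraph.cycleGraph k)) ∧
          DistinctSpheres.HasInfiniteMotion (DistinctSpheres.directProduct T (SimpleGraph.cycleGraph k))) ∧
    (¬ ∀ (W : Type) (G : SimpleGraph W), Countable W → Infinite W → G.Connected →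
        DistinctSpheres.IsVertexTransitive G → DistinctSpheres.IsDistinguishable 2 G →
          DistinctSpheres.DSC G) ∧
    (¬ ∀ (W : Type) (G : SimpleGraph W), Countable W → Infinite W → G.Connected →
        DistinctSpheres.IsVertexTransitive G → DistinctSpheres.HasInfiniteMotion G →
          DistinctSpheres.DSC G) := by
  obtain ⟨hconn, hcount, hinf, htrans, hdsc, hdist, hmotion⟩ :=
    DistinctSpheres.directProduct_tree_cycleGraph DistinctSpheres.intPath 2 7 le_rfl
      DistinctSpheres.isTree_intPath DistinctSpheres.isRegularOfDegree_intPath le_rfl (by decide)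
  refine ⟨fun V T _ r k hr hT hreg hk hodd =>
    DistinctSpheres.directProduct_tree_cycleGraph T r k hr hT hreg hk hodd,
    fun h => hdsc (h _ _ hcount hinf hconn htrans hdist),
    fun h => hdsc (h _ _ hcount hinf hconn htrans hmotion)⟩
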